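/- **Setting.** Fix integers $d_v,d_c\ge 1$, a density factor $\alpha\in[0,1]$ and a continuous (atomless) probability distribution $f$ on $\mathbb R$. For $n$ such that $m=nd_v/d_c$ is an integer, let $G$ be uniformly distributed among the bipartite graphs without parallel edges on $n$ variable nodes and $m$ check nodes in which every variable node has degree $d_v$ and every check node has degree $d_c$. Independently of $G$, let the variable nodes carry i.i.d. values $x_v$, each equal to $0$ with probability $1-\alpha$ and distributed according to $f$ with probability $\alpha$; let $\mathcal K=\{v: x_v\neq 0\}$. Initially the value of a check node is the sum of the values of its neighbors; the decoder knows $G$ and these sums. **Algorithms.** In Genie, the decoder is also told $\mathcal K$ and works on the subgraph induced by $\mathcal K$. In the other algorithms, all variable nodes that have a neighboring check node of value $0$ are removed before the first iteration. In each iteration all the variable nodes which the rule below verifies, applied to the graph and the check values at the beginning of the iteration, are verified; the verified values are then subtracted from the values of the neighboring check nodes, and the verified nodes are removed. (If the rule admits several values for a node, any of them may be assigned.) In what follows, $\mathcal M(\cdot)$ denotes the set of neighbors in the current graph. * *LM* and *Genie*: verify every variable node adjacent to a check node of degree one, with the value of that check node. * *SBB*: whenever two distinct check nodes $c_i,c_j\in\mathcal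 M(u)$ of some remaining variable node $u$ have the same value $g$, verify all nodes of $(\mathcal M(c_i)\cup\mathcal M(c_j))\setminus(\mathcal M(c_i)\cap\mathcal M(c_j))$ to zero, and if $\mathcal M(c_i)\cap\mathcal M(c_j)=\{u\}$ verify $u$ with the value $g$. * *XH*: verify every variable node for which at least $\lceil d_v/2\rceil$ of the neighboring check nodes have the same value, with that value. **Partition.** For a set $\mathcal V^*$ of variable nodes, let $\mathcal N_i$ be the set of check nodes of degree $i$ in the subgraph induced by $\mathcal V^*$, and let $\mathcal X_i$ be the set of nodes of $\mathcal V^*$ that have $i$ edges into $\mathcal N_1$. Let $\mathcal K_\Delta$ be the set of zero-valued variable nodes all of whose $d_v$ edges lead to check nodes that have at least one neighbor in $\mathcal K$, and let $\mathcal K'=\mathcal K\cup\mathcal K_\Delta$. In each iteration, $\mathcal V^*$ is the set of those nodes of $\mathcal K$ (for Genie, SBB and XH), respectively of $\mathcal K'$ (for LM), that are still unverified at the beginning of the iteration. **Theorem.** Fix an iteration $\ell$. As $n\to\infty$, for each of the following statements the probability that it fails for a given variable node $v$ tends to $0$, uniformly in $v$. 1. Genie: $v$ is verified in iteration $\ell$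 if and only if $v\in\bigcup_{i=1}^{d_v}\mathcal X_i$. 2. SBB: if $v\in\mathcal K$, then $v$ is verified in iteration $\ell$ if and only if $v\in\bigcup_{i=2}^{d_v}\mathcal X_i$. 3. XH, for $d_v\ge 3$: if $v\in\mathcal K$, then $v$ is verified in iteration $\ell$ if and only if $v\in\bigcup_{i=\lceil d_v/2\rceil}^{d_v}\mathcal X_i$. 4. LM: $v$ is verified in iteration $\ell$ if and only if $v\in\bigcup_{i=1}^{d_v}\mathcal X_i$. -/

import Mathlib

open MeasureTheory ProbabilityTheory

namespace Sensing

/-! ### Sensing graphs -/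

/-- A bipartite graph without parallel edges between the variable nodes `Fin n` and the check nodes
`Fin m`, given by its incidence matrix, which is the sensing matrix (all edge weights are 1). -/
abbrev SensingGraph (n m : ℕ) : Type := Fin n → Fin m → Bool

/-- The check nodes incident to the variable node `v`. -/
def checksOf {n m : ℕ} (G : SensingGraph n m) (v : Fin n) : Finset (Fin m) :=
  Finset.univ.filter (fun c => G v c = true)

/-- The variable nodes incident to the check node `c`. -/
def varsOf {n m : ℕ} (G : SensingGraph n m) (c : Fin m) : Finset (Fin n) :=
  Finset.univ.filter (fun v => G v c = true)

/-- The `(dv, dc)`-regular graphs. -/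
def regularGraphs (n m dv dc : ℕ) : Set (SensingGraph n m) :=
  {G | (∀ v, (checksOf G v).card = dv) ∧ ∀ c, (varsOf G c).card = dc}

/-! ### Signal and measurements -/

/-- The support set of the signal. -/
noncomputable def support {n : ℕ} (x : Fin n → ℝ) : Finset (Fin n) :=
  Finset.univ.filter (fun v => x v ≠ 0)

/-- The measurement at the check node `c`: the sum of the signal elements incident to `c`. -/
def measurement {n m : ℕ} (G : SensingGraph n m) (x : Fin n → ℝ) (c : Fin m) : ℝ :=
  ∑ v ∈ varsOf G c, x v

/-- The law of one signal element: zero with probability `1 - α`, and distributed according to `f`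
with probability `α`. -/
noncomputable def elementLaw (α : ℝ) (f : Measure ℝ) : Measure ℝ :=
  ENNReal.ofReal (1 - α) • Measure.dirac 0 + ENNReal.ofReal α • f

/-- The joint law of graph and signal: the graph is uniform among the `(dv, dc)`-regular graphs, the
signal elements are i.i.d. with law `elementLaw α f`, and graph and signal are independent. -/
noncomputable def ensemble (n m dv dc : ℕ) (α : ℝ) (f : Measure ℝ) :
    Measure (SensingGraph n m × (Fin n → ℝ)) :=
  (uniformOn (regularGraphs n m dv dc)).prod (Measure.pi (fun _ : Fin n => elementLaw α f))

/-! ### The recovery algorithms -/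

/-- The four recovery algorithms. -/
inductive Algorithm : Type
  | genie
  | sbb
  | xh
  | lm

/-- What an algorithm knows at the beginning of an iteration: the variable nodes that are still in
the graph, and the current (residual) values of the check nodes. -/
structure State (n m : ℕ) where
  unverified : Finset (Fin n)
  value : Fin m → ℝ

/-- The neighbors of the check node `c` in the current graph. -/
def liveVars {n m : ℕ} (G : SensingGraph n m) (S : State n m) (c : Fin m) : Finset (Fin n) :=
  varsOf G c ∩ S.unverified

/-- The state before the first iteration. Genie knows the support, and works on the subgraph induced
by it. The other algorithms first remove every variable node that has a check node of value 0. -/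
noncomputable def initialState {n m : ℕ} (A : Algorithm) (G : SensingGraph n m) (x : Fin n → ℝ) :
    State n m where
  unverified :=
    match A with
    | .genie => support x
    | _ => Finset.univ.filter (fun v => ∀ c ∈ checksOf G v, measurement G x c ≠ 0)
  value := measurement G x

/-- LM and Genie: the values of the check nodes of degree one connected to `v`. -/
def degreeOneRule {n m : ℕ} (G : SensingGraph n m) (S : State n m) (v : Fin n) : Set ℝ :=
  {g | ∃ c ∈ checksOf G v, liveVars G S c = {v} ∧ S.value c = g}

/-- SBB: `v` is verified with the common value `g` of two of its check nodes if it is the only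
variable node connected to both; and it is verified to zero if two distinct check nodes of equal
value share some variable node `u`, and `v` is adjacent to exactly one of these two check nodes. -/
def sbbRule {n m : ℕ} (G : SensingGraph n m) (S : State n m) (v : Fin n) : Set ℝ :=
  {g | ∃ c₁ ∈ checksOf G v, ∃ c₂ ∈ checksOf G v, c₁ ≠ c₂ ∧ S.value c₁ = g ∧ S.value c₂ = g ∧
      liveVars G S c₁ ∩ liveVars G S c₂ = {v}} ∪
  {g | g = 0 ∧ ∃ u ∈ S.unverified, ∃ c₁ ∈ checksOf G u, ∃ c₂ ∈ checksOf G u, c₁ ≠ c₂ ∧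
      S.value c₁ = S.value c₂ ∧
      v ∈ (liveVars G S c₁ ∪ liveVars G S c₂) \ (liveVars G S c₁ ∩ liveVars G S c₂)}

/-- XH: the values taken by at least `⌈dv / 2⌉` of the check nodes of `v`. -/
def xhRule {n m : ℕ} (dv : ℕ) (G : SensingGraph n m) (S : State n m) (v : Fin n) : Set ℝ :=
  {g | ⌈(dv : ℚ) / 2⌉₊ ≤ ((checksOf G v).filter (fun c => S.value c = g)).card}

/-- The values with which the algorithm may verify the variable node `v` in the current iteration. -/
def rule {n m : ℕ} (A : Algorithm) (dv : ℕ) (G : SensingGraph n m) (S : State n m) (v : Fin n) : Set ℝ :=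
  match A with
  | .genie => degreeOneRule G S v
  | .sbb => sbbRule G S v
  | .xh => xhRule dv G S v
  | .lm => degreeOneRule G S v

open scoped Classical in
/-- The variable nodes that are verified in the iteration that starts from the state `S`. -/
noncomputable def verified {n m : ℕ} (A : Algorithm) (dv : ℕ) (G : SensingGraph n m) (S : State n m) :
    Finset (Fin n) :=
  S.unverified.filter (fun v => (rule A dv G S v).Nonempty)

/-- One iteration. Every variable node that can be verified is verified with an admissible value `a v`
(should the rule admit several values, any of them may be chosen); the verified values are subtracted
from the neighboring check nodes, and the verified nodes are removed. -/
def Step {n m : ℕ} (A : Algorithm) (dv : ℕ) (G : SensingGraph n m) (S S' : State n m) : Prop :=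
  ∃ a : Fin n → ℝ,
    (∀ v ∈ verified A dv G S, a v ∈ rule A dv G S v) ∧
    S'.unverified = S.unverified \ verified A dv G S ∧
    ∀ c, S'.value c = S.value c - ∑ v ∈ varsOf G c ∩ verified A dv G S, a v

/-- `S ℓ` is the state at the beginning of iteration `ℓ` (counted from 0) in a run of the algorithm.
A run without further progress stays in its state. -/
def IsRun {n m : ℕ} (A : Algorithm) (dv : ℕ) (G : SensingGraph n m) (x : Fin n → ℝ) (S : ℕ → State n m) :
    Prop :=
  S 0 = initialState A G x ∧ ∀ ℓ, Step A dv G (S ℓ) (S (ℓ + 1))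

/-- Every input has a run. -/
theorem exists_isRun {n m : ℕ} (A : Algorithm) (dv : ℕ) (G : SensingGraph n m) (x : Fin n → ℝ) :
    ∃ S, IsRun A dv G x S := by
  classical
  have h : ∀ S : State n m, ∃ S', Step A dv G S S' := by
    intro S
    let a : Fin n → ℝ := fun v => if hv : (rule A dv G S v).Nonempty then hv.some else 0
    refine ⟨⟨S.unverified \ verified A dv G S,
      fun c => S.value c - ∑ v ∈ varsOf G c ∩ verified A dv G S, a v⟩, a, ?_, rfl, fun _ => rfl⟩
    intro v hv
    have hv' : (rule A dv G S v).Nonempty := (Finset.mem_filter.mp hv).2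
    simp only [a, dif_pos hv']
    exact hv'.some_mem
  choose next hnext using h
  exact ⟨fun ℓ => Nat.rec (initialState A G x) (fun _ S => next S) ℓ, rfl, fun ℓ => hnext _⟩

/-! ### The partition of the induced subgraph -/

/-- `𝒩ᵢ`: the check nodes of degree `i` in the subgraph induced by the set `V` of variable nodes. -/
def checkClass {n m : ℕ} (G : SensingGraph n m) (V : Finset (Fin n)) (i : ℕ) : Finset (Fin m) :=
  Finset.univ.filter (fun c => (varsOf G c ∩ V).card = i)

/-- `𝒳ᵢ`: the variable nodes of `V` with `i` edges into `𝒩₁`. -/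
def varClass {n m : ℕ} (G : SensingGraph n m) (V : Finset (Fin n)) (i : ℕ) : Finset (Fin n) :=
  V.filter (fun v => (checksOf G v ∩ checkClass G V 1).card = i)

/-- `𝒦_Δ`: the zero-valued variable nodes with `dv` edges into `𝒩₁ ∪ … ∪ 𝒩_dc`, where the `𝒩ᵢ` are
those of the subgraph induced by the support. -/
noncomputable def deltaSet {n m : ℕ} (dv dc : ℕ) (G : SensingGraph n m) (x : Fin n → ℝ) :
    Finset (Fin n) :=
  Finset.univ.filter (fun v => x v = 0 ∧
    (checksOf G v ∩ (Finset.Icc 1 dc).biUnion (checkClass G (support x))).card = dv)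

/-- The set inducing the subgraph: `𝒦' = 𝒦 ∪ 𝒦_Δ` for LM, and `𝒦` for the other algorithms. -/
noncomputable def inducingSet {n m : ℕ} (A : Algorithm) (dv dc : ℕ) (G : SensingGraph n m)
    (x : Fin n → ℝ) : Finset (Fin n) :=
  match A with
  | .lm => support x ∪ deltaSet dv dc G x
  | _ => support x

/-- The threshold `β`. -/
def threshold (A : Algorithm) (dv : ℕ) : ℕ :=
  match A with
  | .genie => 1
  | .sbb => 2
  | .xh => ⌈(dv : ℚ) / 2⌉₊
  | .lm => 1

/-- The set `𝒳_β ∪ … ∪ 𝒳_dv` in the iteration that starts from the state `S`; the subgraph is induced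
by the nodes of the inducing set that are still unverified. -/
noncomputable def modelSet {n m : ℕ} (A : Algorithm) (dv dc : ℕ) (G : SensingGraph n m) (x : Fin n → ℝ)
    (S : State n m) : Finset (Fin n) :=
  (Finset.Icc (threshold A dv) dv).biUnion (varClass G (inducingSet A dv dc G x ∩ S.unverified))

/-- In iteration `ℓ`, the variable node `v` is verified if and only if it lies in
`𝒳_β ∪ … ∪ 𝒳_dv` (whatever choices the algorithm makes among admissible values). -/
def ModelHolds {n m : ℕ} (A : Algorithm) (dv dc : ℕ) (ℓ : ℕ) (v : Fin n) (G : SensingGraph n m)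
    (x : Fin n → ℝ) : Prop :=
  ∀ S : ℕ → State n m, IsRun A dv G x S →
    (v ∈ verified A dv G (S ℓ) ↔ v ∈ modelSet A dv dc G x (S ℓ))

/-- A property of a variable node in a random `(dv, dc)`-regular graph with a random signal holds
asymptotically almost surely: the probability that it fails tends to 0, uniformly in the node, as `n`
tends to infinity along the values for which `m = n * dv / dc` is an integer. -/
def AAS (dv dc : ℕ) (α : ℝ) (f : Measure ℝ)
    (E : ∀ n m : ℕ, Fin n → SensingGraph n m → (Fin n → ℝ) → Prop) : Prop :=
  ∀ ε : ENNReal, 0 < ε → ∃ N : ℕ, ∀ n m : ℕ, N ≤ n → n * dv = m * dc → ∀ v : Fin n,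
    ensemble n m dv dc α f {ω | ¬ E n m v ω.1 ω.2} ≤ ε

end Sensing

namespace Sensing

/-! ### Generic signals -/

/-! The randomness enters through two events only, and on them the statement is deterministic.
First, the signal is almost surely `Generic`: an equation between two different subset sums pins one
nonzero element to a single value, and the law has no atom off 0 (`pi_not_generic`). Second, with
probability 1 - O(1/n) no 4-cycle passes near `v`; this is a switching argument
(`card_not_fourCycleFreeAt_mul_le`), carried to bounded distance by double counting and
exchangeability (`card_not_fourCycleFreeNear_mul_le`).

For Genie and LM the live graph contains only nodes of the inducing set, so the degree-one rule is
the model itself. For SBB and XH, as long as check values equal the sums of live neighbors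
(`Consistent`), equal values mean equal sets of live support neighbors. SBB therefore never errs,
and needs the absence of 4-cycles only so that `v` is the unique common neighbor of two checks. XH
can err at a 4-cycle, and errors travel one neighborhood per iteration; iteration `ℓ` thus needs
freeness up to distance `2 * ℓ` (`IsRun.consistent_xh`). -/

/-- Distinct sets of nonzero signal elements have distinct sums. -/
def Generic {n : ℕ} (x : Fin n → ℝ) : Prop :=
  ∀ A B : Finset (Fin n), A ⊆ support x → B ⊆ support x →
    ∑ v ∈ A, x v = ∑ v ∈ B, x v → A = B

theorem isProbabilityMeasure_elementLaw {α : ℝ} (hα0 : 0 ≤ α) (hα1 : α ≤ 1) (f : Measure ℝ)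
    [IsProbabilityMeasure f] : IsProbabilityMeasure (elementLaw α f) := by
  constructor
  simp only [elementLaw, Measure.add_apply, Measure.smul_apply, measure_univ, smul_eq_mul, mul_one]
  rw [← ENNReal.ofReal_add (by linarith) hα0]
  simp

theorem elementLaw_singleton_of_ne_zero (α : ℝ) (f : Measure ℝ) [NullSingletonClass f] {a : ℝ}
    (ha : a ≠ 0) : elementLaw α f {a} = 0 := by
  simp [elementLaw, ha.symm]

/-- With the other coordinates fixed, the equation determines `x v`. A nonzero solution is a null
point; the solution 0, a possible atom, is excluded by the condition `x v ≠ 0`. -/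
theorem pi_sum_eq_sum_null {n : ℕ} (μ : Measure ℝ) [SigmaFinite μ] (hμ : ∀ a, a ≠ 0 → μ {a} = 0)
    (A B : Finset (Fin n)) (v : Fin n) (hA : v ∈ A) (hB : v ∉ B) :
    Measure.pi (fun _ : Fin n => μ) {x | x v ≠ 0 ∧ ∑ u ∈ A, x u = ∑ u ∈ B, x u} = 0 := by
  set T : Set (Fin n → ℝ) := {x | x v ≠ 0 ∧ ∑ u ∈ A, x u = ∑ u ∈ B, x u}
  have hmeas : MeasurableSet T := by
    refine MeasurableSet.inter ?_ ?_
    · exact (measurable_pi_apply v (measurableSet_singleton 0)).compl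
    · exact measurableSet_eq_fun (by fun_prop) (by fun_prop)
  have hf : Measurable (T.indicator (1 : (Fin n → ℝ) → ENNReal)) :=
    measurable_one.indicator hmeas
  -- Integrate over coordinate `v` first; the inner integral already vanishes.
  rw [← lintegral_indicator_one hmeas, lintegral_eq_lmarginal_univ (0 : Fin n → ℝ),
    lmarginal_erase' _ hf (Finset.mem_univ v)]
  have hzero : (fun x : Fin n → ℝ =>
      ∫⁻ t, T.indicator (1 : (Fin n → ℝ) → ENNReal) (Function.update x v t) ∂μ) = fun _ => 0 := by
    funext x
    have hsub : (fun t => Function.update x v t) ⁻¹' T ⊆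
        {t | t ≠ 0 ∧ t = ∑ u ∈ B, x u - ∑ u ∈ A.erase v, x u} := by
      rintro t ⟨h0, h1⟩
      rw [← Finset.add_sum_erase A _ hA] at h1
      have e1 : ∑ u ∈ A.erase v, Function.update x v t u = ∑ u ∈ A.erase v, x u :=
        Finset.sum_congr rfl fun u hu => by
          rw [Function.update_of_ne (Finset.ne_of_mem_erase hu)]
      have e2 : ∑ u ∈ B, Function.update x v t u = ∑ u ∈ B, x u :=
        Finset.sum_congr rfl fun u hu => by
          rw [Function.update_of_ne (ne_of_mem_of_not_mem hu hB)]
      rw [e1, e2] at h1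
      simp only [Function.update_self] at h0 h1
      exact ⟨h0, by linarith⟩
    have hnull : μ ((fun t => Function.update x v t) ⁻¹' T) = 0 := by
      refine measure_mono_null hsub ?_
      by_cases h : ∑ u ∈ B, x u - ∑ u ∈ A.erase v, x u = 0
      · rw [show {t : ℝ | t ≠ 0 ∧ t = ∑ u ∈ B, x u - ∑ u ∈ A.erase v, x u} = ∅ by
          ext t; simp [h]]
        simp
      · exact measure_mono_null (fun t ht => ht.2) (hμ _ h)
    have hcomp : (fun t => T.indicator (1 : (Fin n → ℝ) → ENNReal) (Function.update x v t)) =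
        ((fun t => Function.update x v t) ⁻¹' T).indicator 1 := by
      funext t
      simp [Set.indicator]
    rw [hcomp, lintegral_indicator_one ((measurable_update x) hmeas), hnull]
  rw [hzero]
  simp [lmarginal]

theorem pi_not_generic {n : ℕ} (μ : Measure ℝ) [SigmaFinite μ] (hμ : ∀ a, a ≠ 0 → μ {a} = 0) :
    Measure.pi (fun _ : Fin n => μ) {x | ¬ Generic x} = 0 := by
  have hsub : {x : Fin n → ℝ | ¬ Generic x} ⊆ ⋃ (A : Finset (Fin n)) (B : Finset (Fin n))
      (v : Fin n) (_ : v ∈ A) (_ : v ∉ B), {x | x v ≠ 0 ∧ ∑ u ∈ A, x u = ∑ u ∈ B, x u} := by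
    intro x hx
    simp only [Generic, Set.mem_ofPred_eq, not_forall] at hx
    obtain ⟨A, B, hA, hB, hsum, hne⟩ := hx
    simp only [Set.mem_iUnion]
    by_cases hAB : A ⊆ B
    · obtain ⟨v, hvB, hvA⟩ := Finset.not_subset.mp
        (fun h => hne (Finset.Subset.antisymm hAB h) : ¬ B ⊆ A)
      exact ⟨B, A, v, hvB, hvA, (Finset.mem_filter.mp (hB hvB)).2, hsum.symm⟩
    · obtain ⟨v, hvA, hvB⟩ := Finset.not_subset.mp hAB
      exact ⟨A, B, v, hvA, hvB, (Finset.mem_filter.mp (hA hvA)).2, hsum⟩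
  refine measure_mono_null hsub ?_
  simp only [measure_iUnion_null_iff]
  exact fun A B v hA hB => pi_sum_eq_sum_null μ hμ A B v hA hB

end Sensing
namespace Sensing

/-! ### Short cycles in random regular graphs -/

variable {n m : ℕ}

@[simp]
theorem mem_checksOf {G : SensingGraph n m} {v : Fin n} {c : Fin m} :
    c ∈ checksOf G v ↔ G v c = true := by
  simp [checksOf]

@[simp]
theorem mem_varsOf {G : SensingGraph n m} {v : Fin n} {c : Fin m} :
    v ∈ varsOf G c ↔ G v c = true := by
  simp [varsOf]

/-- No cycle of length 4 passes through the variable node `v`. -/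
def FourCycleFreeAt (G : SensingGraph n m) (v : Fin n) : Prop :=
  ∀ c₁ c₂ u, c₁ ≠ c₂ → G v c₁ = true → G v c₂ = true → G u c₁ = true → G u c₂ = true → u = v

/-- No cycle of length 4 passes through a variable node within distance `2 * k` of `v`. -/
def FourCycleFreeNear (G : SensingGraph n m) : ℕ → Fin n → Prop
  | 0, v => FourCycleFreeAt G v
  | k + 1, v => FourCycleFreeAt G v ∧
      ∀ c u, G v c = true → G u c = true → FourCycleFreeNear G k u

theorem FourCycleFreeNear.fourCycleFreeAt {G : SensingGraph n m} {k : ℕ} {v : Fin n}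
    (h : FourCycleFreeNear G k v) : FourCycleFreeAt G v := by
  cases k with
  | zero => exact h
  | succ k => exact h.1

theorem fourCycleFreeAt_comp (σ : Equiv.Perm (Fin n)) (G : SensingGraph n m) (v : Fin n) :
    FourCycleFreeAt (fun u => G (σ u)) v ↔ FourCycleFreeAt G (σ v) := by
  refine forall₂_congr fun c₁ c₂ => σ.forall_congr fun u => ?_
  simp only [σ.injective.eq_iff]

theorem fourCycleFreeNear_comp (σ : Equiv.Perm (Fin n)) (G : SensingGraph n m) (k : ℕ)
    (v : Fin n) :
    FourCycleFreeNear (fun u => G (σ u)) k v ↔ FourCycleFreeNear G k (σ v) := by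
  induction k generalizing v with
  | zero => exact fourCycleFreeAt_comp σ G v
  | succ k ih =>
    refine and_congr (fourCycleFreeAt_comp σ G v) (forall_congr' fun c => σ.forall_congr fun u => ?_)
    rw [ih]

theorem comp_mem_regularGraphs (σ : Equiv.Perm (Fin n)) {dv dc : ℕ} {G : SensingGraph n m}
    (hG : G ∈ regularGraphs n m dv dc) : (fun u => G (σ u)) ∈ regularGraphs n m dv dc := by
  refine ⟨fun v => hG.1 (σ v), fun c => ?_⟩
  rw [← hG.2 c]
  refine Finset.card_bij (fun u _ => σ u) (by simp) (by simp) fun u hu => ⟨σ.symm u, ?_, by simp⟩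
  simpa using hu

/-! ### Switchings and the rarity of 4-cycles at a node -/

/-- The edges `(v, c)` and `(w, d)` are replaced by `(v, d)` and `(w, c)`. -/
def switch (G : SensingGraph n m) (v w : Fin n) (c d : Fin m) : SensingGraph n m :=
  fun a b => if a = v ∨ a = w then G a (Equiv.swap c d b) else G a b

theorem switch_switch (G : SensingGraph n m) (v w : Fin n) (c d : Fin m) :
    switch (switch G v w c d) v w c d = G := by
  funext a b
  by_cases h : a = v ∨ a = w <;> simp [switch, h]

theorem switch_mem_regularGraphs {dv dc : ℕ} {G : SensingGraph n m}
    (hG : G ∈ regularGraphs n m dv dc) {v w : Fin n} {c d : Fin m} (hvc : G v c = true)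
    (hwd : G w d = true) (hvd : G v d = false) (hwc : G w c = false) :
    switch G v w c d ∈ regularGraphs n m dv dc := by
  refine ⟨fun a => ?_, fun b => ?_⟩
  · rw [← hG.1 a]
    by_cases h : a = v ∨ a = w
    · refine Finset.card_bij (fun b _ => Equiv.swap c d b) ?_ (by simp)
        fun b hb => ⟨Equiv.swap c d b, ?_, by simp⟩
      · simp [switch, h]
      · simpa [switch, h] using hb
    · congr 1
      ext b
      simp [switch, h]
  · rw [← hG.2 b]
    have hvw : v ≠ w := by rintro rfl; simp [hvc] at hwc
    have hcd : c ≠ d := by rintro rfl; simp [hvc] at hvd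
    by_cases hb : b = c ∨ b = d
    -- Rows are permuted by the swap of `c` and `d`. Columns `c` and `d` are permuted by the swap of
    -- `v` and `w`, and the other columns do not change.
    · have key : ∀ a, switch G v w c d a b = G (Equiv.swap v w a) b := by
        intro a
        by_cases hav : a = v
        · subst hav
          rcases hb with rfl | rfl <;> simp [switch, hvc, hwd, hvd, hwc]
        · by_cases haw : a = w
          · subst haw
            rcases hb with rfl | rfl <;> simp [switch, hvc, hwd, hvd, hwc]
          · simp [switch, hav, haw, Equiv.swap_apply_of_ne_of_ne]
      refine Finset.card_bij (fun a _ => Equiv.swap v w a) ?_ (by simp)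
        fun a ha => ⟨Equiv.swap v w a, ?_, by simp⟩
      · simp [key]
      · simpa [key] using ha
    · push Not at hb
      congr 1
      ext a
      simp [switch, Equiv.swap_apply_of_ne_of_ne hb.1 hb.2]

theorem card_biUnion_varsOf_le {dv dc : ℕ} {G : SensingGraph n m}
    (hG : G ∈ regularGraphs n m dv dc) (v : Fin n) :
    ((checksOf G v).biUnion (varsOf G)).card ≤ dv * dc := by
  have := Finset.card_biUnion_le_card_mul (checksOf G v) (varsOf G) dc fun c _ => (hG.2 c).le
  rwa [hG.1 v] at this

-- If `v` lies on a 4-cycle through `c`, switch the edge `(v, c)` with an edge `(w, d)`, for any of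
-- the at least `n - dv * dc` nodes `w` sharing no check with `v`. The rest of the cycle survives as
-- a path from `v` to `c`, so boundedly many choices of `(d, c, w)` suffice to undo the switch.
open scoped Classical in
theorem card_not_fourCycleFreeAt_mul_le {dv dc : ℕ} (hdv : 1 ≤ dv) (v : Fin n) :
    ((regularGraphs n m dv dc).toFinset.filter (fun G => ¬ FourCycleFreeAt G v)).card *
      (n - dv * dc) ≤
    (regularGraphs n m dv dc).toFinset.card * (dv * (dv * dc * dv * dc)) := by
  set R := (regularGraphs n m dv dc).toFinset with hR
  set C := R.filter (fun G => ¬ FourCycleFreeAt G v) with hC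
  set W : SensingGraph n m → Finset (Fin n) :=
    fun G => Finset.univ \ (checksOf G v).biUnion (varsOf G) with hW
  -- Candidates `(d, c, w)` in the switched graph: `d` is adjacent to `v`, and `(c, w)` ends a path
  -- `v - c' - u - c - w`.
  set back : SensingGraph n m → Finset (Fin m × Fin m × Fin n) := fun G =>
    checksOf G v ×ˢ ((((checksOf G v).biUnion (varsOf G)).biUnion (checksOf G)).biUnion
      fun c => (varsOf G c).image fun w => (c, w)) with hback
  have hRmem : ∀ G, G ∈ R ↔ G ∈ regularGraphs n m dv dc := fun G => by simp [hR]
  have hWcard : ∀ G ∈ C, n - dv * dc ≤ (W G).card := by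
    intro G hG
    have h1 := card_biUnion_varsOf_le ((hRmem G).1 (Finset.mem_filter.mp hG).1) v
    have h2 := Finset.le_card_sdiff ((checksOf G v).biUnion (varsOf G)) Finset.univ
    rw [Finset.card_univ, Fintype.card_fin] at h2
    exact le_trans (by omega) h2
  have hbackcard : ∀ G ∈ R, (back G).card ≤ dv * (dv * dc * dv * dc) := by
    intro G hG
    have hG' := (hRmem G).1 hG
    have h1 := card_biUnion_varsOf_le hG' v
    have h2 := Finset.card_biUnion_le_card_mul ((checksOf G v).biUnion (varsOf G)) (checksOf G)
      dv fun u _ => (hG'.1 u).le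
    have h3 := Finset.card_biUnion_le_card_mul
      (((checksOf G v).biUnion (varsOf G)).biUnion (checksOf G))
      (fun c => (varsOf G c).image fun w => (c, w)) dc
      fun c _ => Finset.card_image_le.trans (hG'.2 c).le
    rw [hback, Finset.card_product, hG'.1 v]
    exact Nat.mul_le_mul_left _ (h3.trans (Nat.mul_le_mul_right _
      (h2.trans (Nat.mul_le_mul_right _ h1))))
  have hsub : C.sigma W ⊆ (R.sigma back).image
      fun q => (⟨switch q.1 v q.2.2.2 q.2.2.1 q.2.1, q.2.2.2⟩ : Σ _ : SensingGraph n m, Fin n) := by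
    rintro ⟨G, w⟩ hGw
    obtain ⟨hG, hw⟩ := Finset.mem_sigma.mp hGw
    obtain ⟨hGR, hcyc⟩ := Finset.mem_filter.mp hG
    rw [hRmem] at hGR
    simp only [FourCycleFreeAt, not_forall] at hcyc
    obtain ⟨c', c, u, hcc, hvc', hvc, huc', huc, huv⟩ := hcyc
    have hw' : ∀ b, G v b = true → G w b = false := by
      simpa [hW] using hw
    obtain ⟨d, hd⟩ : (checksOf G w).Nonempty := by
      rw [← Finset.card_pos, hGR.1 w]
      omega
    have hwd : G w d = true := mem_checksOf.mp hd
    have hwc : G w c = false := hw' c hvc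
    have hvd : G v d = false := by
      by_contra h
      simp [hw' d (by simpa using h)] at hwd
    have huw : u ≠ w := by rintro rfl; simp [huc] at hwc
    have hcd : c ≠ d := by rintro rfl; simp [hvc] at hvd
    have hcd' : c' ≠ d := by rintro rfl; simp [hvc'] at hvd
    refine Finset.mem_image.mpr ⟨⟨switch G v w c d, d, c, w⟩, ?_, by simp [switch_switch]⟩
    refine Finset.mem_sigma.mpr ⟨(hRmem _).2 (switch_mem_regularGraphs hGR hvc hwd hvd hwc), ?_⟩
    simp only [hback, Finset.mem_product, Finset.mem_biUnion, Finset.mem_image, mem_checksOf,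
      mem_varsOf]
    refine ⟨by simp [switch, hvc], c, ⟨u, ⟨c', ?_, ?_⟩, ?_⟩, w, ?_, rfl⟩
    · simp [switch, Equiv.swap_apply_of_ne_of_ne hcc hcd', hvc']
    · simp [switch, huv, huw, huc']
    · simp [switch, huv, huw, huc]
    · simp [switch, hwd]
  calc C.card * (n - dv * dc) ≤ (C.sigma W).card := by
        rw [Finset.card_sigma, ← smul_eq_mul]
        exact Finset.card_nsmul_le_sum _ _ _ hWcard
    _ ≤ (R.sigma back).card := (Finset.card_le_card hsub).trans Finset.card_image_le
    _ ≤ R.card * (dv * (dv * dc * dv * dc)) := by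
        rw [Finset.card_sigma, ← smul_eq_mul]
        exact Finset.sum_le_card_nsmul _ _ _ hbackcard

/-! ### From 4-cycles at a node to 4-cycles near it -/

open scoped Classical in
theorem card_not_fourCycleFreeNear_succ_le {dv dc : ℕ} {G : SensingGraph n m}
    (hG : G ∈ regularGraphs n m dv dc) (k : ℕ) :
    (Finset.univ.filter fun v => ¬ FourCycleFreeNear G (k + 1) v).card ≤
      (Finset.univ.filter fun v => ¬ FourCycleFreeNear G k v).card * (1 + dv * dc) := by
  set B := Finset.univ.filter fun v => ¬ FourCycleFreeNear G k v with hB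
  have hsub : (Finset.univ.filter fun v => ¬ FourCycleFreeNear G (k + 1) v) ⊆
      B ∪ B.biUnion fun u => (checksOf G u).biUnion (varsOf G) := by
    intro v hv
    by_cases h : FourCycleFreeAt G v
    · simp only [FourCycleFreeNear, Finset.mem_filter, not_and, not_forall] at hv
      obtain ⟨c, u, hvc, huc, hu⟩ := hv.2 h
      refine Finset.mem_union_right _ (Finset.mem_biUnion.mpr ⟨u, by simp [hB, hu], ?_⟩)
      exact Finset.mem_biUnion.mpr ⟨c, by simp [huc], by simp [hvc]⟩
    · refine Finset.mem_union_left _ ?_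
      simp only [hB, Finset.mem_filter, Finset.mem_univ, true_and]
      exact fun h' => h h'.fourCycleFreeAt
  refine (Finset.card_le_card hsub).trans ((Finset.card_union_le _ _).trans ?_)
  rw [mul_add, mul_one]
  exact Nat.add_le_add_left
    (Finset.card_biUnion_le_card_mul _ _ _ fun u _ => card_biUnion_varsOf_le hG u) _

open scoped Classical in
theorem card_not_fourCycleFreeNear_le {dv dc : ℕ} {G : SensingGraph n m}
    (hG : G ∈ regularGraphs n m dv dc) (k : ℕ) :
    (Finset.univ.filter fun v => ¬ FourCycleFreeNear G k v).card ≤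
      (Finset.univ.filter fun v => ¬ FourCycleFreeNear G 0 v).card * (1 + dv * dc) ^ k := by
  induction k with
  | zero => simp
  | succ k ih =>
    rw [pow_succ, ← mul_assoc]
    exact (card_not_fourCycleFreeNear_succ_le hG k).trans (Nat.mul_le_mul_right _ ih)

-- Exchangeability: relabeling by a transposition permutes the regular graphs. An average over all
-- nodes thus bounds each single node.
open scoped Classical in
theorem card_not_fourCycleFreeNear_eq (dv dc k : ℕ) (v w : Fin n) :
    ((regularGraphs n m dv dc).toFinset.filter (fun G => ¬ FourCycleFreeNear G k v)).card =
    ((regularGraphs n m dv dc).toFinset.filter (fun G => ¬ FourCycleFreeNear G k w)).card := by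
  refine Finset.card_bij' (fun G _ u => G (Equiv.swap v w u)) (fun G _ u => G (Equiv.swap v w u))
    ?_ ?_ (by simp) (by simp)
  · intro G hG
    simp only [Finset.mem_filter, Set.mem_toFinset, fourCycleFreeNear_comp,
      Equiv.swap_apply_right] at hG ⊢
    exact ⟨comp_mem_regularGraphs _ hG.1, hG.2⟩
  · intro G hG
    simp only [Finset.mem_filter, Set.mem_toFinset, fourCycleFreeNear_comp,
      Equiv.swap_apply_left] at hG ⊢
    exact ⟨comp_mem_regularGraphs _ hG.1, hG.2⟩

open scoped Classical in
theorem sum_card_not_fourCycleFreeNear (dv dc k : ℕ) (v : Fin n) :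
    ∑ G ∈ (regularGraphs n m dv dc).toFinset,
      (Finset.univ.filter fun u => ¬ FourCycleFreeNear G k u).card =
    n * ((regularGraphs n m dv dc).toFinset.filter fun G => ¬ FourCycleFreeNear G k v).card := by
  have h := Finset.sum_card_bipartiteAbove_eq_sum_card_bipartiteBelow
    (s := (regularGraphs n m dv dc).toFinset) (t := (Finset.univ : Finset (Fin n)))
    (fun G u => ¬ FourCycleFreeNear G k u)
  simp only [Finset.bipartiteAbove, Finset.bipartiteBelow] at h
  rw [h, Finset.sum_congr rfl fun u _ => card_not_fourCycleFreeNear_eq dv dc k u v]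
  simp

open scoped Classical in
/-- In a random regular graph, short cycles near a given variable node are rare. -/
theorem card_not_fourCycleFreeNear_mul_le {dv dc : ℕ} (hdv : 1 ≤ dv) (k : ℕ) (v : Fin n) :
    ((regularGraphs n m dv dc).toFinset.filter (fun G => ¬ FourCycleFreeNear G k v)).card *
      (n - dv * dc) ≤
    (regularGraphs n m dv dc).toFinset.card *
      (dv * (dv * dc * dv * dc) * (1 + dv * dc) ^ k) := by
  have h0 := card_not_fourCycleFreeAt_mul_le (m := m) (dc := dc) hdv v
  have h1 := Finset.sum_le_sum fun G (hG : G ∈ (regularGraphs n m dv dc).toFinset) =>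
    card_not_fourCycleFreeNear_le (Set.mem_toFinset.mp hG) k
  rw [← Finset.sum_mul, sum_card_not_fourCycleFreeNear dv dc k v,
    sum_card_not_fourCycleFreeNear dv dc 0 v, mul_assoc] at h1
  -- Both sides carry the factor `n`, positive because `v : Fin n` exists.
  have h2 := Nat.le_of_mul_le_mul_left h1 v.pos
  calc _ ≤ _ := Nat.mul_le_mul_right _ h2
    _ = _ := Nat.mul_right_comm _ _ _
    _ ≤ _ := Nat.mul_le_mul_right _ h0
    _ = _ := mul_assoc _ _ _

end Sensing
-- From counting to probability
namespace Sensing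

open scoped Classical in
theorem uniformOn_not_fourCycleFreeNear_le {dv dc : ℕ} (hdv : 1 ≤ dv) (k : ℕ) {ε : ENNReal}
    (hε : 0 < ε) : ∃ N : ℕ, ∀ n m : ℕ, N ≤ n → ∀ v : Fin n,
      uniformOn (regularGraphs n m dv dc)
        {G | G ∈ regularGraphs n m dv dc → ¬ FourCycleFreeNear G k v} ≤ ε := by
  set K := dv * (dv * dc * dv * dc) * (1 + dv * dc) ^ k with hK
  obtain ⟨j, hj⟩ := ENNReal.exists_nat_mul_gt hε.ne' (ENNReal.natCast_ne_top K)
  -- The bad fraction is at most `K / (n - dv * dc)`, and `K < j * ε`; the extra 1 keeps the divisor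
  -- nonzero.
  refine ⟨dv * dc + j + 1, fun n m hn v => ?_⟩
  set R := regularGraphs n m dv dc with hR
  have hcard := card_not_fourCycleFreeNear_mul_le (m := m) (dc := dc) hdv k v
  rw [← hK, ← hR] at hcard
  set B := R.toFinset.filter (fun G => ¬ FourCycleFreeNear G k v) with hB
  have hinter : R ∩ {G | G ∈ R → ¬ FourCycleFreeNear G k v} = (B : Set (SensingGraph n m)) := by
    ext G
    simp +contextual [hB]
  have hRcount : Measure.count R = (R.toFinset.card : ENNReal) := by
    rw [← Measure.count_apply_finset, Set.coe_toFinset]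
  rw [uniformOn, cond_apply R.toFinite.measurableSet, hinter, Measure.count_apply_finset, hRcount]
  rcases Nat.eq_zero_or_pos R.toFinset.card with h0 | hpos
  · have : B.card = 0 := Nat.le_zero.mp (h0 ▸ Finset.card_filter_le _ _)
    simp [this]
  rw [mul_comm, ← div_eq_mul_inv]
  refine ENNReal.div_le_of_le_mul ?_
  have hj' : (((n - dv * dc : ℕ) : ENNReal)) ≠ 0 := by
    rw [Nat.cast_ne_zero]; omega
  refine (ENNReal.mul_le_mul_iff_left hj' (ENNReal.natCast_ne_top _)).mp ?_
  calc (B.card : ENNReal) * ((n - dv * dc : ℕ) : ENNReal) ≤ R.toFinset.card * K := by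
        exact_mod_cast hcard
    _ ≤ R.toFinset.card * (j * ε) := by gcongr
    _ ≤ R.toFinset.card * (((n - dv * dc : ℕ) : ENNReal) * ε) := by
        gcongr; omega
    _ = _ := by ring

/-- A property that holds for generic signals on regular graphs without short cycles near the
variable node holds asymptotically almost surely. -/
theorem aas_of_generic {dv dc : ℕ} (hdv : 1 ≤ dv) {α : ℝ} (hα0 : 0 ≤ α) (hα1 : α ≤ 1)
    (f : Measure ℝ) [IsProbabilityMeasure f] [NullSingletonClass f] (k : ℕ)
    {E : ∀ n m : ℕ, Fin n → SensingGraph n m → (Fin n → ℝ) → Prop}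
    (h : ∀ n m v G x, G ∈ regularGraphs n m dv dc → Generic x → FourCycleFreeNear G k v →
      E n m v G x) : AAS dv dc α f E := by
  intro ε hε
  obtain ⟨N, hN⟩ := uniformOn_not_fourCycleFreeNear_le (dc := dc) hdv k hε
  refine ⟨N, fun n m hn _ v => ?_⟩
  have := isProbabilityMeasure_elementLaw hα0 hα1 f
  -- Covering by two rectangles avoids any measurability requirement on `E`.
  have hsub : {ω : SensingGraph n m × (Fin n → ℝ) | ¬ E n m v ω.1 ω.2} ⊆
      {G | G ∈ regularGraphs n m dv dc → ¬ FourCycleFreeNear G k v} ×ˢ Set.univ ∪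
        Set.univ ×ˢ {x | ¬ Generic x} := by
    rintro ⟨G, x⟩ hω
    by_cases hx : Generic x
    · exact Or.inl ⟨fun hG hF => hω (h n m v G x hG hx hF), trivial⟩
    · exact Or.inr ⟨trivial, hx⟩
  refine (measure_mono hsub).trans ((measure_union_le _ _).trans ?_)
  rw [ensemble, Measure.prod_prod, Measure.prod_prod,
    pi_not_generic _ fun a ha => elementLaw_singleton_of_ne_zero α f ha]
  simpa using hN n m hn v

end Sensing
namespace Sensing

/-! ### The algorithms on generic signals -/

variable {n m : ℕ}

@[simp]
theorem mem_support {x : Fin n → ℝ} {v : Fin n} : v ∈ support x ↔ x v ≠ 0 := by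
  simp [support]

@[simp]
theorem mem_liveVars {G : SensingGraph n m} {S : State n m} {v : Fin n} {c : Fin m} :
    v ∈ liveVars G S c ↔ G v c = true ∧ v ∈ S.unverified := by
  simp [liveVars]

theorem mem_verified {A : Algorithm} {dv : ℕ} {G : SensingGraph n m} {S : State n m} {v : Fin n} :
    v ∈ verified A dv G S ↔ v ∈ S.unverified ∧ (rule A dv G S v).Nonempty := by
  simp [verified]

/-- The check nodes of `v` that have no other neighbor in `V`. -/
def lonelyChecks (G : SensingGraph n m) (V : Finset (Fin n)) (v : Fin n) : Finset (Fin m) :=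
  (checksOf G v).filter fun c => varsOf G c ∩ V = {v}

/-- The upper index `dv` is automatic by regularity, so the union over classes becomes one
inequality. -/
theorem mem_modelSet {A : Algorithm} {dv dc : ℕ} {G : SensingGraph n m}
    (hG : G ∈ regularGraphs n m dv dc) {x : Fin n → ℝ} {S : State n m} {v : Fin n} :
    v ∈ modelSet A dv dc G x S ↔ (v ∈ inducingSet A dv dc G x ∧ v ∈ S.unverified) ∧
      threshold A dv ≤ (lonelyChecks G (inducingSet A dv dc G x ∩ S.unverified) v).card := by
  set V := inducingSet A dv dc G x ∩ S.unverified with hV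
  have hmem : v ∈ inducingSet A dv dc G x ∧ v ∈ S.unverified ↔ v ∈ V := by simp [hV]
  rw [hmem]
  have hlonely : v ∈ V → checksOf G v ∩ checkClass G V 1 = lonelyChecks G V v := by
    intro hv
    ext c
    simp only [checkClass, lonelyChecks, Finset.mem_inter, Finset.mem_filter, Finset.mem_univ,
      true_and, mem_checksOf, Finset.card_eq_one]
    refine and_congr_right fun hc => ⟨?_, fun h => ⟨v, h⟩⟩
    rintro ⟨w, hw⟩
    have hvw : v ∈ varsOf G c ∩ V := by simp [hc, hv]
    rw [hw, Finset.mem_singleton] at hvw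
    rw [hw, hvw]
  have hle : (lonelyChecks G V v).card ≤ dv := by
    rw [← hG.1 v]
    exact Finset.card_filter_le _ _
  simp only [modelSet, Finset.mem_biUnion, Finset.mem_Icc, varClass, Finset.mem_filter, ← hV]
  constructor
  · rintro ⟨i, hi, hv, hc⟩
    rw [hlonely hv] at hc
    exact ⟨hv, hc ▸ hi.1⟩
  · rintro ⟨hv, ht⟩
    exact ⟨_, ⟨ht, hle⟩, hv, by rw [hlonely hv]⟩

theorem degreeOneRule_nonempty {G : SensingGraph n m} {S : State n m} {v : Fin n} :
    (degreeOneRule G S v).Nonempty ↔ 1 ≤ (lonelyChecks G S.unverified v).card := by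
  rw [Nat.one_le_iff_ne_zero, ← Nat.pos_iff_ne_zero, Finset.card_pos]
  constructor
  · rintro ⟨_, c, hc, h, _⟩
    exact ⟨c, Finset.mem_filter.mpr ⟨hc, h⟩⟩
  · rintro ⟨c, hc⟩
    obtain ⟨hc, h⟩ := Finset.mem_filter.mp hc
    exact ⟨_, c, hc, h, rfl⟩

theorem Step.unverified_subset {A : Algorithm} {dv : ℕ} {G : SensingGraph n m} {S S' : State n m}
    (h : Step A dv G S S') : S'.unverified ⊆ S.unverified := by
  obtain ⟨a, -, h, -⟩ := h
  rw [h]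
  exact Finset.sdiff_subset

theorem IsRun.unverified_subset {A : Algorithm} {dv : ℕ} {G : SensingGraph n m} {x : Fin n → ℝ}
    {S : ℕ → State n m} (h : IsRun A dv G x S) (ℓ : ℕ) :
    (S ℓ).unverified ⊆ (initialState A G x).unverified := by
  induction ℓ with
  | zero => rw [h.1]
  | succ ℓ ih => exact (h.2 ℓ).unverified_subset.trans ih

/-- The degree-one rule follows the model as soon as only nodes of the inducing set are present. -/
theorem modelHolds_of_degreeOneRule {A : Algorithm} {dv dc : ℕ} {G : SensingGraph n m}
    (hG : G ∈ regularGraphs n m dv dc) {x : Fin n → ℝ}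
    (hrule : ∀ S v, rule A dv G S v = degreeOneRule G S v) (hthr : threshold A dv = 1)
    (hinit : (initialState A G x).unverified ⊆ inducingSet A dv dc G x) (ℓ : ℕ) (v : Fin n) :
    ModelHolds A dv dc ℓ v G x := by
  intro S hS
  have hsub := (hS.unverified_subset ℓ).trans hinit
  rw [mem_verified, mem_modelSet hG, hrule, hthr, Finset.inter_eq_right.mpr hsub,
    degreeOneRule_nonempty]
  exact and_congr_left fun _ => ⟨fun h => ⟨hsub h, h⟩, fun h => h.2⟩

theorem sum_inter_support (x : Fin n → ℝ) (A : Finset (Fin n)) :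
    ∑ v ∈ A ∩ support x, x v = ∑ v ∈ A, x v := by
  refine Finset.sum_subset Finset.inter_subset_left fun v hv hv' => ?_
  by_contra h
  exact hv' (by simp [hv, h])

theorem Generic.inter_support_eq {x : Fin n → ℝ} (hx : Generic x) {A B : Finset (Fin n)}
    (h : ∑ v ∈ A, x v = ∑ v ∈ B, x v) : A ∩ support x = B ∩ support x := by
  refine hx _ _ Finset.inter_subset_right Finset.inter_subset_right ?_
  rw [sum_inter_support, sum_inter_support, h]

theorem Generic.measurement_eq_zero_iff {x : Fin n → ℝ} (hx : Generic x) (G : SensingGraph n m)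
    (c : Fin m) : measurement G x c = 0 ↔ varsOf G c ∩ support x = ∅ := by
  constructor
  · intro h
    have := hx.inter_support_eq (A := varsOf G c) (B := ∅) (by simpa [measurement] using h)
    simpa using this
  · intro h
    rw [measurement, ← sum_inter_support, h, Finset.sum_empty]

theorem Generic.support_subset_initialState {x : Fin n → ℝ} (hx : Generic x) (A : Algorithm)
    (G : SensingGraph n m) : support x ⊆ (initialState A G x).unverified := by
  intro v hv
  have key : ∀ c ∈ checksOf G v, measurement G x c ≠ 0 := by
    intro c hc h0
    rw [hx.measurement_eq_zero_iff] at h0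
    exact Finset.notMem_empty v (h0 ▸ Finset.mem_inter.mpr ⟨by simpa using hc, hv⟩)
  cases A with
  | genie => exact hv
  | sbb => exact Finset.mem_filter.mpr ⟨Finset.mem_univ v, key⟩
  | xh => exact Finset.mem_filter.mpr ⟨Finset.mem_univ v, key⟩
  | lm => exact Finset.mem_filter.mpr ⟨Finset.mem_univ v, key⟩

theorem Generic.initialState_lm_subset {dv dc : ℕ} {G : SensingGraph n m}
    (hG : G ∈ regularGraphs n m dv dc) {x : Fin n → ℝ} (hx : Generic x) :
    (initialState .lm G x).unverified ⊆ inducingSet .lm dv dc G x := by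
  intro v hv
  have hv' : ∀ c ∈ checksOf G v, measurement G x c ≠ 0 := (Finset.mem_filter.mp hv).2
  by_cases hxv : x v = 0
  · refine Finset.mem_union_right _ (Finset.mem_filter.mpr ⟨Finset.mem_univ v, hxv, ?_⟩)
    rw [Finset.inter_eq_left.mpr, hG.1 v]
    intro c hc
    refine Finset.mem_biUnion.mpr ⟨(varsOf G c ∩ support x).card, Finset.mem_Icc.mpr ⟨?_, ?_⟩,
      by simp [checkClass]⟩
    · rw [Nat.one_le_iff_ne_zero, Ne, Finset.card_eq_zero, ← hx.measurement_eq_zero_iff]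
      exact hv' c hc
    · exact (hG.2 c) ▸ Finset.card_le_card Finset.inter_subset_left
  · exact Finset.mem_union_left _ (mem_support.mpr hxv)

/-! ### Consistency of the check values -/

/-- The value of the check node `c` is the sum of the signal elements of its neighbors in the
current graph. -/
def Consistent (G : SensingGraph n m) (x : Fin n → ℝ) (S : State n m) (c : Fin m) : Prop :=
  S.value c = ∑ v ∈ liveVars G S c, x v

theorem Generic.consistent_initialState {x : Fin n → ℝ} (hx : Generic x) (A : Algorithm)
    (G : SensingGraph n m) (c : Fin m) : Consistent G x (initialState A G x) c := by
  have hsub := hx.support_subset_initialState A G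
  have hle : liveVars G (initialState A G x) c ⊆ varsOf G c := Finset.inter_subset_left
  refine (Finset.sum_subset hle fun v hv hv' => ?_).symm
  by_contra h
  exact hv' (Finset.mem_inter.mpr ⟨hv, hsub (mem_support.mpr h)⟩)

/-- Correctness is required only at live neighbors of `c`; this locality is what makes XH tractable.
-/
theorem Consistent.step {A : Algorithm} {dv : ℕ} {G : SensingGraph n m} {x : Fin n → ℝ}
    {S S' : State n m} {c : Fin m} (hc : Consistent G x S c) (h : Step A dv G S S')
    (hcorrect : ∀ v, G v c = true → v ∈ S.unverified → ∀ g ∈ rule A dv G S v, g = x v) :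
    Consistent G x S' c := by
  obtain ⟨a, ha, hU, hval⟩ := h
  have hverif : ∑ v ∈ varsOf G c ∩ verified A dv G S, a v =
      ∑ v ∈ varsOf G c ∩ verified A dv G S, x v := by
    refine Finset.sum_congr rfl fun v hv => ?_
    obtain ⟨hvc, hv⟩ := Finset.mem_inter.mp hv
    exact hcorrect v (by simpa using hvc) (mem_verified.mp hv).1 _ (ha v hv)
  have hsub : varsOf G c ∩ verified A dv G S ⊆ liveVars G S c :=
    Finset.inter_subset_inter_left fun v hv => (mem_verified.mp hv).1
  have hlive : liveVars G S' c = liveVars G S c \ (varsOf G c ∩ verified A dv G S) := by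
    ext v
    simp only [mem_liveVars, hU, Finset.mem_sdiff, Finset.mem_inter, mem_varsOf]
    tauto
  rw [Consistent, hval c, hverif, hc, hlive, ← Finset.sum_sdiff hsub]
  ring

theorem Generic.liveVars_inter_support_eq {G : SensingGraph n m} {x : Fin n → ℝ} {S : State n m}
    (hx : Generic x) {c₁ c₂ : Fin m} (h₁ : Consistent G x S c₁) (h₂ : Consistent G x S c₂)
    (h : S.value c₁ = S.value c₂) :
    liveVars G S c₁ ∩ support x = liveVars G S c₂ ∩ support x :=
  hx.inter_support_eq (by rw [← h₁, ← h₂, h])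

/-- The inclusion, rather than an equality, also covers `x v = 0`, where the intersection is empty.
-/
theorem Consistent.value_eq {G : SensingGraph n m} {x : Fin n → ℝ} {S : State n m} {c : Fin m}
    {v : Fin n} (hc : Consistent G x S c) (h : liveVars G S c ∩ support x ⊆ {v})
    (hv : v ∈ S.unverified) (hvc : G v c = true) : S.value c = x v := by
  rw [hc, ← sum_inter_support]
  by_cases hxv : x v = 0
  · rw [hxv]
    refine Finset.sum_eq_zero fun u hu => ?_
    rw [Finset.mem_singleton.mp (h hu), hxv]
  · rw [Finset.Subset.antisymm h (by simp [hv, hvc, hxv]), Finset.sum_singleton]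

theorem lonelyChecks_support {G : SensingGraph n m} {x : Fin n → ℝ} {S : State n m} {v : Fin n}
    {c : Fin m} : c ∈ lonelyChecks G (support x ∩ S.unverified) v ↔
      G v c = true ∧ liveVars G S c ∩ support x = {v} := by
  rw [lonelyChecks, Finset.mem_filter, mem_checksOf, liveVars, Finset.inter_assoc,
    Finset.inter_comm S.unverified]

/-- Two checks of equal value have the same live support neighbors. A node adjacent to only one of
them is thus zero, and a unique common neighbor is the only possible support neighbor of either. -/
theorem sbbRule_correct {G : SensingGraph n m} {x : Fin n → ℝ} {S : State n m} (hx : Generic x)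
    (hS : ∀ c, Consistent G x S c) {v : Fin n} (hv : v ∈ S.unverified) {g : ℝ}
    (hg : g ∈ sbbRule G S v) :
    g = x v ∧ (x v ≠ 0 → 2 ≤ (lonelyChecks G (support x ∩ S.unverified) v).card) := by
  rcases hg with ⟨c₁, hc₁, c₂, hc₂, hne, rfl, hval, hlive⟩ | ⟨rfl, u, -, c₁, -, c₂, -, -, hval, hd⟩
  · rw [mem_checksOf] at hc₁ hc₂
    have heq := hx.liveVars_inter_support_eq (hS c₁) (hS c₂) hval.symm
    have hsub : liveVars G S c₁ ∩ support x ⊆ {v} := by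
      rw [← hlive]
      intro u hu
      have hu' := hu
      rw [heq] at hu'
      exact Finset.mem_inter.mpr ⟨(Finset.mem_inter.mp hu).1, (Finset.mem_inter.mp hu').1⟩
    refine ⟨(hS c₁).value_eq hsub hv hc₁, fun hxv => ?_⟩
    have h₁ : liveVars G S c₁ ∩ support x = {v} :=
      Finset.Subset.antisymm hsub (by simp [hv, hc₁, hxv])
    exact Finset.one_lt_card.mpr ⟨c₁, lonelyChecks_support.mpr ⟨hc₁, h₁⟩, c₂,
      lonelyChecks_support.mpr ⟨hc₂, heq ▸ h₁⟩, hne⟩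
  · have heq := hx.liveVars_inter_support_eq (hS c₁) (hS c₂) hval
    have hxv : x v = 0 := by
      by_contra hxv
      have := Finset.ext_iff.mp heq v
      simp only [Finset.mem_inter, mem_support, Finset.mem_sdiff, Finset.mem_union] at this hd
      tauto
    exact ⟨hxv.symm, fun h => absurd hxv h⟩

theorem sbbRule_nonempty {G : SensingGraph n m} {x : Fin n → ℝ} {S : State n m}
    (hS : ∀ c, Consistent G x S c) {v : Fin n} (hv : v ∈ S.unverified) (hfree : FourCycleFreeAt G v)
    (h : 2 ≤ (lonelyChecks G (support x ∩ S.unverified) v).card) : (sbbRule G S v).Nonempty := by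
  obtain ⟨c₁, h₁, c₂, h₂, hne⟩ := Finset.one_lt_card.mp h
  rw [lonelyChecks_support] at h₁ h₂
  refine ⟨x v, Or.inl ⟨c₁, by simp [h₁.1], c₂, by simp [h₂.1], hne,
    (hS c₁).value_eq h₁.2.subset hv h₁.1, (hS c₂).value_eq h₂.2.subset hv h₂.1, ?_⟩⟩
  ext u
  simp only [Finset.mem_inter, mem_liveVars, Finset.mem_singleton]
  constructor
  · rintro ⟨h, h'⟩
    exact hfree c₁ c₂ u hne h₁.1 h₂.1 h.1 h'.1
  · rintro rfl
    exact ⟨⟨h₁.1, hv⟩, h₂.1, hv⟩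

theorem IsRun.consistent_sbb {dv : ℕ} {G : SensingGraph n m} {x : Fin n → ℝ} (hx : Generic x)
    {S : ℕ → State n m} (hS : IsRun .sbb dv G x S) (ℓ : ℕ) (c : Fin m) :
    Consistent G x (S ℓ) c := by
  induction ℓ generalizing c with
  | zero => exact hS.1 ▸ hx.consistent_initialState .sbb G c
  | succ ℓ ih =>
    exact (ih c).step (hS.2 ℓ) fun v _ hv g hg => (sbbRule_correct hx ih hv hg).1

theorem modelHolds_sbb {dv dc : ℕ} {G : SensingGraph n m} (hG : G ∈ regularGraphs n m dv dc)
    {x : Fin n → ℝ} (hx : Generic x) (ℓ : ℕ) {v : Fin n} (hv : v ∈ support x)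
    (hfree : FourCycleFreeAt G v) : ModelHolds .sbb dv dc ℓ v G x := by
  intro S hS
  have hcons := hS.consistent_sbb hx ℓ
  rw [mem_verified, mem_modelSet hG]
  constructor
  · rintro ⟨hU, g, hg⟩
    exact ⟨⟨hv, hU⟩, (sbbRule_correct hx hcons hU hg).2 (mem_support.mp hv)⟩
  · rintro ⟨⟨-, hU⟩, h⟩
    exact ⟨hU, sbbRule_nonempty hcons hU hfree h⟩

/-- For XH to be reliable, two checks must agree; at `dv ≤ 2` the threshold would let a single check
verify. -/
theorem two_le_ceil_half {dv : ℕ} (hdv : 3 ≤ dv) : 2 ≤ ⌈(dv : ℚ) / 2⌉₊ := by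
  refine Nat.lt_ceil.mpr ?_
  have : (3 : ℚ) ≤ dv := by exact_mod_cast hdv
  push_cast
  linarith

/-- Live support neighbors of one of two agreeing checks are adjacent to both; without a 4-cycle at
`v` only `v` remains. -/
theorem xhRule_correct {dv : ℕ} (hdv : 3 ≤ dv) {G : SensingGraph n m} {x : Fin n → ℝ}
    {S : State n m} (hx : Generic x) {v : Fin n} (hS : ∀ c, G v c = true → Consistent G x S c)
    (hv : v ∈ S.unverified) (hfree : FourCycleFreeAt G v) {g : ℝ} (hg : g ∈ xhRule dv G S v) :
    g = x v ∧ (x v ≠ 0 →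
      ⌈(dv : ℚ) / 2⌉₊ ≤ (lonelyChecks G (support x ∩ S.unverified) v).card) := by
  have hg' : ⌈(dv : ℚ) / 2⌉₊ ≤ ((checksOf G v).filter (fun c => S.value c = g)).card := hg
  obtain ⟨c₁, h₁, c₂, h₂, hne⟩ := Finset.one_lt_card.mp ((two_le_ceil_half hdv).trans hg')
  simp only [Finset.mem_filter, mem_checksOf] at h₁ h₂
  have heq := hx.liveVars_inter_support_eq (hS c₁ h₁.1) (hS c₂ h₂.1) (h₁.2.trans h₂.2.symm)
  have hsub : liveVars G S c₁ ∩ support x ⊆ {v} := by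
    intro u hu
    have hu' := hu
    rw [heq] at hu'
    simp only [Finset.mem_inter, mem_liveVars] at hu hu'
    exact Finset.mem_singleton.mpr (hfree c₁ c₂ u hne h₁.1 h₂.1 hu.1.1 hu'.1.1)
  refine ⟨h₁.2 ▸ (hS c₁ h₁.1).value_eq hsub hv h₁.1, fun hxv => hg'.trans ?_⟩
  refine Finset.card_le_card fun c hc => ?_
  simp only [Finset.mem_filter, mem_checksOf] at hc
  refine lonelyChecks_support.mpr ⟨hc.1, ?_⟩
  rw [hx.liveVars_inter_support_eq (hS c hc.1) (hS c₁ h₁.1) (hc.2.trans h₁.2.symm)]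
  exact Finset.Subset.antisymm hsub (by simp [hv, h₁.1, hxv])

theorem xhRule_nonempty {dv : ℕ} {G : SensingGraph n m} {x : Fin n → ℝ} {S : State n m}
    {v : Fin n} (hS : ∀ c, G v c = true → Consistent G x S c) (hv : v ∈ S.unverified)
    (h : ⌈(dv : ℚ) / 2⌉₊ ≤ (lonelyChecks G (support x ∩ S.unverified) v).card) :
    (xhRule dv G S v).Nonempty := by
  refine ⟨x v, h.trans (Finset.card_le_card fun c hc => ?_)⟩
  rw [lonelyChecks_support] at hc
  exact Finset.mem_filter.mpr ⟨by simp [hc.1], (hS c hc.1).value_eq hc.2.subset hv hc.1⟩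

theorem IsRun.consistent_xh {dv : ℕ} (hdv : 3 ≤ dv) {G : SensingGraph n m} {x : Fin n → ℝ}
    (hx : Generic x) {S : ℕ → State n m} (hS : IsRun .xh dv G x S) (ℓ : ℕ) {v : Fin n}
    (hfree : FourCycleFreeNear G ℓ v) {c : Fin m} (hvc : G v c = true) :
    Consistent G x (S ℓ) c := by
  induction ℓ generalizing v c with
  | zero => exact hS.1 ▸ hx.consistent_initialState .xh G c
  | succ ℓ ih =>
    -- Taking `v` as its own neighbor through `c` lowers the radius at `v` from `ℓ + 1` to `ℓ`.
    refine (ih (hfree.2 c v hvc hvc) hvc).step (hS.2 ℓ) fun u huc hu g hg => ?_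
    have hu' := hfree.2 c u hvc huc
    exact (xhRule_correct hdv hx (fun c' hc' => ih hu' hc') hu hu'.fourCycleFreeAt hg).1

theorem modelHolds_xh {dv dc : ℕ} (hdv : 3 ≤ dv) {G : SensingGraph n m}
    (hG : G ∈ regularGraphs n m dv dc) {x : Fin n → ℝ} (hx : Generic x) (ℓ : ℕ) {v : Fin n}
    (hv : v ∈ support x) (hfree : FourCycleFreeNear G ℓ v) : ModelHolds .xh dv dc ℓ v G x := by
  intro S hS
  have hcons : ∀ c, G v c = true → Consistent G x (S ℓ) c :=
    fun c hc => hS.consistent_xh hdv hx ℓ hfree hc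
  rw [mem_verified, mem_modelSet hG]
  constructor
  · rintro ⟨hU, g, hg⟩
    exact ⟨⟨hv, hU⟩,
      (xhRule_correct hdv hx hcons hU hfree.fourCycleFreeAt hg).2 (mem_support.mp hv)⟩
  · rintro ⟨⟨-, hU⟩, h⟩
    exact ⟨hU, xhRule_nonempty hcons hU h⟩

end Sensing

theorem theorem2 (dv dc : ℕ) (hdv : 1 ≤ dv) (hdc : 1 ≤ dc) (α : ℝ) (hα0 : 0 ≤ α) (hα1 : α ≤ 1)
    (f : MeasureTheory.Measure ℝ) [MeasureTheory.IsProbabilityMeasure f]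
    [MeasureTheory.NullSingletonClass f] (ℓ : ℕ) :
    -- Genie
    Sensing.AAS dv dc α f (fun _ _ v G x =>
      Sensing.ModelHolds Sensing.Algorithm.genie dv dc ℓ v G x) ∧
    -- SBB
    Sensing.AAS dv dc α f (fun _ _ v G x => v ∈ Sensing.support x →
      Sensing.ModelHolds Sensing.Algorithm.sbb dv dc ℓ v G x) ∧
    -- XH
    (3 ≤ dv → Sensing.AAS dv dc α f (fun _ _ v G x => v ∈ Sensing.support x →
      Sensing.ModelHolds Sensing.Algorithm.xh dv dc ℓ v G x)) ∧
    -- LM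
    Sensing.AAS dv dc α f (fun _ _ v G x =>
      Sensing.ModelHolds Sensing.Algorithm.lm dv dc ℓ v G x) := by
  refine ⟨?_, ?_, fun hdv3 => ?_, ?_⟩
  · exact Sensing.aas_of_generic hdv hα0 hα1 f 0 fun n m v G x hG _ _ =>
      Sensing.modelHolds_of_degreeOneRule hG (fun _ _ => rfl) rfl subset_rfl ℓ v
  · exact Sensing.aas_of_generic hdv hα0 hα1 f 0 fun n m v G x hG hx hfree hv =>
      Sensing.modelHolds_sbb hG hx ℓ hv hfree
  · exact Sensing.aas_of_generic hdv hα0 hα1 f ℓ fun n m v G x hG hx hfree hv =>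
      Sensing.modelHolds_xh hdv3 hG hx ℓ hv hfree
  · exact Sensing.aas_of_generic hdv hα0 hα1 f 0 fun n m v G x hG hx _ =>
      Sensing.modelHolds_of_degreeOneRule hG (fun _ _ => rfl) rfl
        (hx.initialState_lm_subset hG) ℓ v
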